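/- For a random variable $W$ supported on $\mathbb Z_+=\{0,1,2,\dots\}$ write $p_W[n]=\mathbb P(W=n)$ and $\lambda_W=\mathbb E W$. Let $\mathcal T(W)$ be the circularly symmetric random variable on $\mathbb C$ with density $$p_{\mathcal T(W)}(r)=\sum_{n=0}^\infty p_W[n]\,\frac{e^{-|r|^2}|r|^{2n}}{n!\,\pi},$$ and let $\mathcal T^{-1}$ send a random variable $V$ on $\mathbb C$ with density $p_V$ to the sequence $$n\mapsto \frac1\pi\int_{\mathbb C}\Big(\int_{\mathbb C}p_V(r)\,e^{r s^*-r^* s}\,dr\Big)\mathcal L_n(|s|^2)\,ds ,$$ where $\mathcal L_n(x)=\sum_{k=0}^n\binom nk\frac{(-x)^k}{k!}$ is the $n$-th Laguerre polynomial. For $0\le\eta\le1$ the beamsplitter addition of $X$ and $Y$ is $X\boxplus_\eta Y=\mathcal T^{-1}\big(\sqrt\eta\,\mathcal T(X)+\sqrt{1-\eta}\,\mathcal T(Y)\big)$, with $\mathcal T(X)$ and $\mathcal T(Y)$ independent. Let $X$ be any random variable on $\mathbb Z_+$, let $Y$ be geometric on $\mathbb Z_+$, that is $p_Y[n]=\theta(1-\theta)^n$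 for some $\theta\in(0,1]$, with mean $\lambda_Y$, and let $Z_\eta=X\boxplus_\eta Y$. Then: (i) for every $\eta\in[0,1]$, $p_{Z_\eta}$ is a probability mass function on $\mathbb Z_+$, and if $\lambda_X<\infty$ its mean is $\lambda(\eta)=\lambda_{Z_\eta}=\eta\lambda_X+(1-\eta)\lambda_Y$; (ii) for every $\eta\in(0,1]$ and $n\in\mathbb Z_+$, the function $\eta\mapsto p_{Z_\eta}[n]$ is differentiable at $\eta$ (from the left if $\eta=1$) and $$\frac{\partial}{\partial\eta}p_{Z_\eta}[n]=\Delta\Big(\frac n\eta\big(p_{Z_\eta}[n-1]\lambda_Y-p_{Z_\eta}[n](1+\lambda_Y)\big)\Big),$$ where $\Delta(u[n])=u[n+1]-u[n]$ and, for $n=0$, the expression in the outer brackets is $0$. -/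

import Mathlib

open MeasureTheory ProbabilityTheory

noncomputable section

namespace Beamsplitter

/-- The `n`-th Laguerre polynomial function `L_n(x) = ∑_{k ≤ n} C(n,k) (-x)^k / k!`. -/
def laguerre (n : ℕ) (x : ℝ) : ℝ :=
  ∑ k ∈ Finset.range (n + 1), (n.choose k : ℝ) * (-x) ^ k / (k.factorial : ℝ)

/-- The probability mass function `p_W[n] = P(W = n)` of a random variable `W` valued in `ℕ`. -/
def pmfOf {Ω : Type*} [MeasurableSpace Ω] (P : Measure Ω) (W : Ω → ℕ) (n : ℕ) : ℝ :=
  P.real (W ⁻¹' {n})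

/-- The density on `ℂ` of the continuous counterpart `T(X)` of a random variable with mass
function `p`: `r ↦ ∑_n p[n] e^{-|r|²} |r|^{2n} / (n! π)`. -/
def continuousDensity (p : ℕ → ℝ) (r : ℂ) : ℝ :=
  ∑' n : ℕ, p n * (Real.exp (-‖r‖ ^ 2) * ‖r‖ ^ (2 * n) / ((n.factorial : ℝ) * Real.pi))

/-- The law on `ℂ` of `T(X)`: the measure with density `continuousDensity p` with respect to
Lebesgue measure. -/
def continuousLaw (p : ℕ → ℝ) : Measure ℂ :=
  (volume : Measure ℂ).withDensity fun r => ENNReal.ofReal (continuousDensity p r)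

/-- The inverse map `T⁻¹`, as an action on laws on `ℂ`:
`n ↦ (1/π) ∫ (∫ exp (r s* - r* s) dν(r)) L_n(|s|²) ds`. For `ν` with density `p` the inner
integral is `∫ p(r) exp (r s* - r* s) dr`. -/
def inverseMap (ν : Measure ℂ) (n : ℕ) : ℝ :=
  ((1 / (Real.pi : ℂ)) * ∫ s : ℂ,
    (∫ r : ℂ, Complex.exp (r * (starRingEnd ℂ) s - (starRingEnd ℂ) r * s) ∂ν) *
      (laguerre n (‖s‖ ^ 2) : ℂ)).re

/-- The law of `√η U + √(1-η) V` for independent `U ∼ μ` and `V ∼ ν`. -/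
def mixedLaw (η : ℝ) (μ ν : Measure ℂ) : Measure ℂ :=
  (μ.prod ν).map fun z : ℂ × ℂ => (Real.sqrt η : ℂ) * z.1 + (Real.sqrt (1 - η) : ℂ) * z.2

/-- Beamsplitter addition, on mass functions: the mass function of
`X ⊞_η Y = T⁻¹(√η T(X) + √(1-η) T(Y))`, where `T(X)` and `T(Y)` are independent and
`X`, `Y` have mass functions `p`, `q`. -/
def beamsplitterAdd (η : ℝ) (p q : ℕ → ℝ) : ℕ → ℝ :=
  inverseMap (mixedLaw η (continuousLaw p) (continuousLaw q))

end Beamsplitter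

end

/-!
Write `l_n(x) = e^{-x} L_n(x)`. The proof rests on the fact that `T` turns the point mass at `n` into
a law on `ℂ` with characteristic function `s ↦ l_n(|s|²)` (`integral_fockDensity_mul_planeChar`).
Hence `T(X)` has characteristic function `∑ p_X[m] l_m(|s|²)`, and orthonormality of the Laguerre
functions on the plane shows that `T⁻¹` recovers a mass function from such an expansion
(`inverseMap_eq`). For geometric `Y` with mean `λ` the law of `T(Y)` is Gaussian, so the
characteristic function of `√η T(X) + √(1-η) T(Y)` is
`∑ p_X[m] l_m(η|s|²) e^{-(1-η)(1+λ)|s|²}`.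

Set `κ = (1-η)λ` and `c = (1-η)(1+λ)`, and let `k_η(m, n)` be the coefficient of `t^n` in
`K_m(t) = (c + (1-c)t)^m / (1 + κ - κt)^{m+1}`. This is the transition kernel of a linear birth and
death process with immigration: a sum of `m` independent linear fractional variables and a
geometric one. The identity `l_m(ηx) e^{-cx} = ∑_n k_η(m, n) l_n(x)`
(`hasSum_coeff_kernelSeries_mul_laguerreExp`) then gives `p_{Z_η}[n] = ∑_m p_X[m] k_η(m, n)`
(`beamsplitterAdd_geometric`). Both this identity and the formula for the characteristic function of
the point masses are proved by summing against `u^m`, which makes everything geometric and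
Gaussian, and comparing coefficients.

Part (i) follows, since `k_η(m, ·)` is a mass function with mean `ηm + κ`. For part (ii), `K_m`
satisfies the first-order equation `η ∂_η K = (1 - t)(λK - (1 + λ - λt) ∂_t K)`, which is the
heat equation for each fixed `m` (`hasDerivAt_coeff_beamsplitterSeries`). Its right-hand side bounds
`∂_η k_η(m, n)` uniformly in `m` when `η` stays away from `0`, so the mixture over `m` may be
differentiated term by term (`hasDerivWithinAt_beamsplitterMixture`).
-/

namespace Beamsplitter

/-! ### Power series and the Laguerre generating function -/

/-- A power series vanishing on `(0, 1)` has zero coefficients. Real parameters in `(0, 1)` suffice,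
so that generating functions need only be computed with nonnegative weights. -/
theorem eq_zero_of_hasSum_pow_smul {E : Type*} [NormedAddCommGroup E] [NormedSpace ℝ E]
    [CompleteSpace E] {a : ℕ → E}
    (h : ∀ u ∈ Set.Ioo (0 : ℝ) 1, HasSum (fun m => u ^ m • a m) 0) (n : ℕ) : a n = 0 := by
  obtain ⟨C, hC⟩ : ∃ C, ∀ m, ‖((1 / 2 : ℝ) ^ m) • a m‖ ≤ C := by
    have h0 := (h (1 / 2) (by norm_num)).summable.tendsto_atTop_zero
    obtain ⟨C, hC⟩ := (Metric.isBounded_range_of_tendsto _ h0).exists_norm_le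
    exact ⟨C, fun m => hC _ ⟨m, rfl⟩⟩
  induction n using Nat.strong_induction_on with
  | _ n ih =>
    -- dividing by `u ^ n` leaves a power series with constant term `a n`
    have hs : ∀ u ∈ Set.Ioo (0 : ℝ) 1, ∑' m, u ^ m • a (m + n) = 0 := by
      intro u hu
      have h1 := (hasSum_nat_add_iff' n).2 (h u hu)
      rw [Finset.sum_eq_zero (fun i hi => by rw [ih i (Finset.mem_range.1 hi), smul_zero]),
        sub_zero] at h1
      have h2 := h1.const_smul ((u ^ n)⁻¹)
      rw [smul_zero] at h2
      refine HasSum.tsum_eq ?_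
      convert! h2 using 2 with m
      rw [smul_smul, pow_add, mul_comm (u ^ m), inv_mul_cancel_left₀ (pow_ne_zero _ hu.1.ne')]
    have hlim : Filter.Tendsto (fun u : ℝ => ∑' m, u ^ m • a (m + n)) (nhdsWithin 0 (Set.Ioi 0))
        (nhds (∑' m, (0 : ℝ) ^ m • a (m + n))) := by
      refine tendsto_tsum_of_dominated_convergence (bound := fun m => (1 / 2) ^ m * (2 ^ n * C))
        ((summable_geometric_of_lt_one (by norm_num) (by norm_num)).mul_right _) ?_ ?_
      · intro m
        exact (((continuous_id.pow m).smul continuous_const).tendsto 0).mono_left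
          nhdsWithin_le_nhds
      · filter_upwards [Ioo_mem_nhdsGT (show (0 : ℝ) < 1 / 4 by norm_num)] with u hu m
        have h3 := hC (m + n)
        rw [norm_smul, Real.norm_of_nonneg (by positivity)] at h3
        rw [norm_smul, Real.norm_of_nonneg (pow_nonneg hu.1.le _)]
        have h4 : u ^ m ≤ (1 / 4) ^ m := pow_le_pow_left₀ hu.1.le hu.2.le m
        calc u ^ m * ‖a (m + n)‖ ≤ (1 / 4) ^ m * ‖a (m + n)‖ := by gcongr
          _ = (1 / 2) ^ m * (2 ^ n * ((1 / 2) ^ (m + n) * ‖a (m + n)‖)) := by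
            rw [show (1 / 4 : ℝ) = 1 / 2 * (1 / 2) by norm_num, mul_pow, pow_add,
              div_pow, div_pow, one_pow]
            field_simp
            rw [one_pow, mul_one]
          _ ≤ _ := by gcongr
    have h0 : (∑' m, (0 : ℝ) ^ m • a (m + n)) = a n := by
      rw [tsum_eq_single 0 (fun m hm => by rw [zero_pow hm, zero_smul])]
      simp
    rw [h0] at hlim
    refine tendsto_nhds_unique hlim (tendsto_const_nhds.congr' ?_)
    filter_upwards [Ioo_mem_nhdsGT (show (0 : ℝ) < 1 by norm_num)] with u hu
    rw [hs u hu]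

theorem hasSum_choose_mul_pow {u : ℝ} (hu : u ∈ Set.Ico (0 : ℝ) 1) (k : ℕ) :
    HasSum (fun m : ℕ => (m.choose k : ℝ) * u ^ m) (u ^ k * (1 / (1 - u) ^ (k + 1))) := by
  have h := (hasSum_choose_mul_geometric_of_norm_lt_one k (r := u)
    (by rw [Real.norm_of_nonneg hu.1]; exact hu.2)).mul_left (u ^ k)
  refine (hasSum_nat_add_iff' k).1 ?_
  rw [Finset.sum_eq_zero (fun i hi => by
    rw [Nat.choose_eq_zero_of_lt (Finset.mem_range.1 hi)]; simp), sub_zero]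
  convert! h using 2 with m
  rw [pow_add]; ring

/-- The generating function of the Laguerre polynomials, from summing the double series
`∑ C(m, k) u^m (-x)^k / k!` over `m` first. -/
theorem hasSum_laguerre_generating {u : ℝ} (hu : u ∈ Set.Ico (0 : ℝ) 1) (x : ℝ) :
    HasSum (fun m : ℕ => u ^ m * laguerre m x) (Real.exp (-x * (u / (1 - u))) / (1 - u)) := by
  have hu1 : 0 < 1 - u := by linarith [hu.2]
  have hexp : ∀ y : ℝ, HasSum (fun k : ℕ => y ^ k / (k.factorial : ℝ) *
      (u ^ k * (1 / (1 - u) ^ (k + 1)))) (Real.exp (y * (u / (1 - u))) / (1 - u)) := by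
    intro y
    have h := NormedSpace.expSeries_div_hasSum_exp (𝔸 := ℝ) (y * (u / (1 - u)))
    rw [← Real.exp_eq_exp_ℝ] at h
    convert! h.div_const (1 - u) using 2 with k
    rw [mul_pow, div_pow, pow_succ]
    field_simp
  let f : ℝ → ℕ × ℕ → ℝ := fun y q =>
    y ^ q.1 / (q.1.factorial : ℝ) * ((q.2.choose q.1 : ℝ) * u ^ q.2)
  have hf : ∀ y k, HasSum (fun m => f y (k, m))
      (y ^ k / (k.factorial : ℝ) * (u ^ k * (1 / (1 - u) ^ (k + 1)))) := fun y k =>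
    (hasSum_choose_mul_pow hu k).mul_left _
  have hsum : Summable (f (-x)) := by
    have hnn : Summable (f |x|) := by
      refine (summable_prod_of_nonneg (fun q => ?_)).2 ⟨fun k => (hf _ k).summable, ?_⟩
      · have := hu.1
        simp only [f, Pi.zero_apply]
        positivity
      · simp_rw [(hf _ _).tsum_eq]
        exact (hexp |x|).summable
    refine Summable.of_norm_bounded hnn (fun q => ?_)
    simp only [f, norm_mul, norm_div, norm_pow, norm_neg, Real.norm_eq_abs, Nat.abs_cast,
      abs_of_nonneg hu.1, le_refl]
  have h1 : HasSum (f (-x)) (Real.exp (-x * (u / (1 - u))) / (1 - u)) := by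
    have h2 := hsum.hasSum.prod_fiberwise (hf (-x))
    rw [← h2.unique (hexp (-x))]
    exact hsum.hasSum
  have h3 := ((Equiv.prodComm ℕ ℕ).hasSum_iff.2 h1).prod_fiberwise
    (g := fun m => u ^ m * laguerre m x) (fun m => ?_)
  · exact h3
  · have hz : ∀ k ∉ Finset.range (m + 1), (f (-x) ∘ Equiv.prodComm ℕ ℕ) (m, k) = 0 := by
      intro k hk
      have : m < k := by simpa [Nat.lt_succ_iff] using hk
      simp [f, Nat.choose_eq_zero_of_lt this]
    convert! hasSum_sum_of_ne_finset_zero (L := .unconditional ℕ) hz using 1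
    rw [laguerre, Finset.mul_sum]
    refine Finset.sum_congr rfl fun k _ => ?_
    simp only [f, Function.comp, Equiv.prodComm_apply, Prod.swap]
    ring

/-- The Laguerre function `e^{-x} L_n(x)`. As a function of `x = |s|²` it is the characteristic
function of `T(W)` for `W` concentrated at `n`. -/
noncomputable def laguerreExp (n : ℕ) (x : ℝ) : ℝ := Real.exp (-x) * laguerre n x

theorem hasSum_laguerreExp_generating {u : ℝ} (hu : u ∈ Set.Ico (0 : ℝ) 1) (x : ℝ) :
    HasSum (fun m : ℕ => u ^ m * laguerreExp m x) (Real.exp (-x / (1 - u)) / (1 - u)) := by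
  have hu1 : 0 < 1 - u := by linarith [hu.2]
  convert! (hasSum_laguerre_generating hu x).mul_left (Real.exp (-x)) using 1
  · ext m; rw [laguerreExp]; ring
  · rw [← mul_div_assoc, ← Real.exp_add]
    congr 2
    field_simp
    ring

/-! ### Orthonormality of the Laguerre functions on the plane -/

theorem integral_norm_pow_mul_exp_neg (k : ℕ) :
    ∫ s : ℂ, ‖s‖ ^ (2 * k) * Real.exp (-‖s‖ ^ 2) = Real.pi * k.factorial := by
  have h := Complex.integral_rpow_mul_exp_neg_rpow (p := 2) (q := 2 * k) (by norm_num)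
    (by have : (0 : ℝ) ≤ k := k.cast_nonneg
        linarith)
  rw [show ((2 * k + 2 : ℝ) / 2) = k + 1 by ring, Real.Gamma_nat_eq_factorial] at h
  convert! h using 1
  · congr 1
    ext s
    norm_cast
  · ring

theorem integrable_norm_pow_mul_exp_neg (k : ℕ) :
    Integrable fun s : ℂ => ‖s‖ ^ (2 * k) * Real.exp (-‖s‖ ^ 2) := by
  refine Integrable.of_integral_ne_zero ?_
  rw [integral_norm_pow_mul_exp_neg]
  positivity

theorem fwdDiff_iter_choose_eq (m j y : ℕ) :
    (fwdDiff 1)^[m] (fun x => x.choose j : ℕ → ℤ) y =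
      if m ≤ j then (y.choose (j - m) : ℤ) else 0 := by
  split_ifs with h
  · obtain ⟨d, rfl⟩ := Nat.exists_eq_add_of_le h
    rw [fwdDiff_iter_choose, Nat.add_sub_cancel_left]
  · obtain ⟨d, rfl⟩ := Nat.exists_eq_add_of_lt (not_le.1 h)
    have h1 := fwdDiff_iter_choose 0 j
    simp only [add_zero, Nat.choose_zero_right, Nat.cast_one] at h1
    rw [show j + d + 1 = d + 1 + j by ring, Function.iterate_add_apply, h1,
      Function.iterate_succ_apply, fwdDiff_const, fwdDiff_iter_eq_sum_shift]
    simp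

/-- The `m`-th difference of a binomial coefficient, written out as an alternating sum. The
orthogonality of the Laguerre polynomials reduces to two instances of it. -/
theorem sum_neg_one_pow_choose_mul_choose_add (m j y : ℕ) :
    ∑ k ∈ Finset.range (m + 1), (-1 : ℝ) ^ k * m.choose k * ((y + k).choose j : ℝ)
      = (-1) ^ m * if m ≤ j then (y.choose (j - m) : ℝ) else 0 := by
  have h := fwdDiff_iter_choose_eq m j y
  rw [fwdDiff_iter_eq_sum_shift] at h
  have h2 := congrArg (fun z : ℤ => (-1 : ℝ) ^ m * (z : ℝ)) h
  push_cast at h2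
  rw [← h2, Finset.mul_sum]
  refine Finset.sum_congr rfl fun k hk => ?_
  obtain ⟨d, rfl⟩ := Nat.exists_eq_add_of_le (Nat.lt_succ_iff.1 (Finset.mem_range.1 hk))
  simp only [pow_add, smul_eq_mul, mul_one, Nat.add_sub_cancel_left]
  push_cast
  ring_nf
  simp [pow_mul']

theorem integral_laguerreExp_mul_pow (m j : ℕ) :
    Integrable (fun s : ℂ => laguerreExp m (‖s‖ ^ 2) * (‖s‖ ^ 2) ^ j) ∧
      ∫ s : ℂ, laguerreExp m (‖s‖ ^ 2) * (‖s‖ ^ 2) ^ j =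
        Real.pi * (j.factorial * ((-1) ^ m * j.choose m)) := by
  have hexp : ∀ s : ℂ, laguerreExp m (‖s‖ ^ 2) * (‖s‖ ^ 2) ^ j =
      ∑ k ∈ Finset.range (m + 1), ((-1 : ℝ) ^ k * m.choose k / k.factorial) *
        (‖s‖ ^ (2 * (j + k)) * Real.exp (-‖s‖ ^ 2)) := by
    intro s
    rw [laguerreExp, laguerre, Finset.mul_sum, Finset.sum_mul]
    refine Finset.sum_congr rfl fun k _ => ?_
    rw [neg_pow, mul_add, pow_add, pow_mul, pow_mul]
    ring
  have hint : ∀ k ∈ Finset.range (m + 1), Integrable fun s : ℂ =>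
      ((-1 : ℝ) ^ k * m.choose k / k.factorial) *
        (‖s‖ ^ (2 * (j + k)) * Real.exp (-‖s‖ ^ 2)) := fun k _ =>
    (integrable_norm_pow_mul_exp_neg (j + k)).const_mul _
  simp_rw [hexp]
  refine ⟨integrable_finsetSum _ hint, ?_⟩
  rw [integral_finsetSum _ hint]
  simp_rw [integral_const_mul, integral_norm_pow_mul_exp_neg]
  have hsum := sum_neg_one_pow_choose_mul_choose_add m j j
  have hc : (if m ≤ j then (j.choose (j - m) : ℝ) else 0) = j.choose m := by
    split_ifs with h
    · rw [Nat.choose_symm h]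
    · rw [Nat.choose_eq_zero_of_lt (not_le.1 h), Nat.cast_zero]
  rw [hc] at hsum
  rw [← hsum, Finset.mul_sum, Finset.mul_sum]
  refine Finset.sum_congr rfl fun k _ => ?_
  rw [Nat.cast_add_choose]
  field_simp

/-- Orthogonality of the Laguerre functions on the plane; the factor `π` is the area element
`ds = π d(|s|²)` of radial functions. -/
theorem integral_laguerreExp_mul_laguerre (m n : ℕ) :
    Integrable (fun s : ℂ => laguerreExp m (‖s‖ ^ 2) * laguerre n (‖s‖ ^ 2)) ∧
      ∫ s : ℂ, laguerreExp m (‖s‖ ^ 2) * laguerre n (‖s‖ ^ 2) =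
        if m = n then Real.pi else 0 := by
  have hexp : ∀ s : ℂ, laguerreExp m (‖s‖ ^ 2) * laguerre n (‖s‖ ^ 2) =
      ∑ j ∈ Finset.range (n + 1), ((-1 : ℝ) ^ j * n.choose j / j.factorial) *
        (laguerreExp m (‖s‖ ^ 2) * (‖s‖ ^ 2) ^ j) := by
    intro s
    rw [laguerre, Finset.mul_sum]
    refine Finset.sum_congr rfl fun j _ => ?_
    rw [neg_pow]
    ring
  have hint : ∀ j ∈ Finset.range (n + 1), Integrable fun s : ℂ =>
      ((-1 : ℝ) ^ j * n.choose j / j.factorial) *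
        (laguerreExp m (‖s‖ ^ 2) * (‖s‖ ^ 2) ^ j) := fun j _ =>
    (integral_laguerreExp_mul_pow m j).1.const_mul _
  simp_rw [hexp]
  refine ⟨integrable_finsetSum _ hint, ?_⟩
  rw [integral_finsetSum _ hint]
  simp_rw [integral_const_mul, (integral_laguerreExp_mul_pow m _).2]
  have hsum := sum_neg_one_pow_choose_mul_choose_add n m 0
  have hc : (-1 : ℝ) ^ n * (if n ≤ m then (Nat.choose 0 (m - n) : ℝ) else 0) =
      (-1) ^ m * if m = n then 1 else 0 := by
    rcases lt_trichotomy m n with h | rfl | h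
    · simp [h.not_ge, h.ne]
    · simp
    · simp [h.le, h.ne', Nat.choose_eq_zero_of_lt (Nat.sub_pos_of_lt h)]
  have hone : (-1 : ℝ) ^ m * (-1) ^ m = 1 := by rw [← mul_pow]; norm_num
  rw [hc] at hsum
  have : (if m = n then Real.pi else 0) =
      Real.pi * ((-1) ^ m * ((-1) ^ m * if m = n then 1 else 0)) := by
    rw [← mul_assoc ((-1 : ℝ) ^ m), hone]
    simp
  rw [this, ← hsum, Finset.mul_sum, Finset.mul_sum]
  refine Finset.sum_congr rfl fun j _ => ?_
  rw [zero_add]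
  field_simp

/-! ### Characteristic functions of continuous counterparts -/

/-- The density of `T(W)` for `W` concentrated at `m`. -/
noncomputable def fockDensity (m : ℕ) (r : ℂ) : ℝ :=
  Real.exp (-‖r‖ ^ 2) * ‖r‖ ^ (2 * m) / ((m.factorial : ℝ) * Real.pi)

theorem fockDensity_nonneg (m : ℕ) (r : ℂ) : 0 ≤ fockDensity m r := by
  unfold fockDensity; positivity

theorem fockDensity_eq (m : ℕ) (r : ℂ) : fockDensity m r =
    (‖r‖ ^ (2 * m) * Real.exp (-‖r‖ ^ 2)) * ((m.factorial : ℝ) * Real.pi)⁻¹ := by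
  rw [fockDensity, div_eq_mul_inv, mul_comm (Real.exp _)]

theorem continuous_fockDensity (m : ℕ) : Continuous (fockDensity m) := by
  unfold fockDensity; fun_prop

theorem integrable_fockDensity (m : ℕ) : Integrable (fockDensity m) := by
  simp_rw [funext (fockDensity_eq m)]
  exact (integrable_norm_pow_mul_exp_neg m).mul_const _

theorem integral_fockDensity (m : ℕ) : ∫ r, fockDensity m r = 1 := by
  simp_rw [fockDensity_eq, integral_mul_const, integral_norm_pow_mul_exp_neg]
  field_simp

/-- The character `r ↦ exp (r s* - r* s)` of `ℂ` attached to `s`. -/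
noncomputable def planeChar (s r : ℂ) : ℂ :=
  Complex.exp (r * (starRingEnd ℂ) s - (starRingEnd ℂ) r * s)

theorem planeChar_exponent (s r : ℂ) : r * (starRingEnd ℂ) s - (starRingEnd ℂ) r * s =
    2 * Complex.I * (inner ℝ (Complex.I * s) r : ℝ) := by
  apply Complex.ext
  · simp [Complex.inner]
  · simp [Complex.inner]
    ring

theorem norm_planeChar (s r : ℂ) : ‖planeChar s r‖ = 1 := by
  rw [planeChar, planeChar_exponent, Complex.norm_exp]
  simp

theorem continuous_planeChar (s : ℂ) : Continuous (planeChar s) := by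
  have : Continuous fun r : ℂ => (starRingEnd ℂ) r := Complex.continuous_conj
  unfold planeChar; fun_prop

theorem planeChar_add (s r r' : ℂ) : planeChar s (r + r') = planeChar s r * planeChar s r' := by
  rw [planeChar, planeChar, planeChar, ← Complex.exp_add, map_add]
  ring_nf

theorem planeChar_ofReal_mul (t : ℝ) (s r : ℂ) : planeChar s (t * r) = planeChar (t * s) r := by
  rw [planeChar, planeChar, map_mul, map_mul, Complex.conj_ofReal]
  ring_nf

theorem integrable_mul_planeChar {f : ℂ → ℝ} (hf : Integrable f) (s : ℂ) :
    Integrable fun r => (f r : ℂ) * planeChar s r :=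
  hf.ofReal.mul_bdd (c := 1) (continuous_planeChar s).aestronglyMeasurable
    (Filter.Eventually.of_forall fun r => (norm_planeChar s r).le)

theorem integral_gaussian_mul_planeChar {b : ℝ} (hb : 0 < b) (s : ℂ) :
    ∫ r, ((Real.exp (-b * ‖r‖ ^ 2) : ℝ) : ℂ) * planeChar s r =
      ((Real.pi * (Real.exp (-‖s‖ ^ 2 / b) / b) : ℝ) : ℂ) := by
  have h := GaussianFourier.integral_cexp_neg_mul_sq_norm_add (V := ℂ) (b := (b : ℂ))
    (by simpa using hb) (2 * Complex.I) (Complex.I * s)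
  have h1 : ∀ r : ℂ, ((Real.exp (-b * ‖r‖ ^ 2) : ℝ) : ℂ) * planeChar s r =
      Complex.exp (-b * ‖r‖ ^ 2 + 2 * Complex.I * (inner ℝ (Complex.I * s) r : ℝ)) := by
    intro r
    rw [planeChar, planeChar_exponent, Complex.exp_add]
    push_cast
    rfl
  simp_rw [h1]
  rw [h]
  have hb' : (b : ℂ) ≠ 0 := by exact_mod_cast hb.ne'
  rw [Complex.finrank_real_complex]
  push_cast
  rw [div_self (two_ne_zero), Complex.cpow_one, mul_pow, Complex.I_sq]
  rw [norm_mul, Complex.norm_I, one_mul, mul_div_assoc', div_mul_eq_mul_div]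
  congr 3
  field_simp
  ring

theorem hasSum_integral_fockDensity {p : ℕ → ℝ} (hp0 : ∀ m, 0 ≤ p m) (hp : Summable p) (s : ℂ) :
    HasSum (fun m => (p m : ℂ) * ∫ r, (fockDensity m r : ℂ) * planeChar s r)
      (∫ r, ((∑' m, p m * fockDensity m r : ℝ) : ℂ) * planeChar s r) := by
  have h := hasSum_integral_of_summable_integral_norm
    (F := fun (m : ℕ) (r : ℂ) => (p m : ℂ) * ((fockDensity m r : ℂ) * planeChar s r))
    (μ := volume) (fun m => (integrable_mul_planeChar (integrable_fockDensity m) s).const_mul _) (by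
      have : ∀ m r, ‖(p m : ℂ) * ((fockDensity m r : ℂ) * planeChar s r)‖ =
          p m * fockDensity m r := by
        intro m r
        rw [norm_mul, norm_mul, norm_planeChar, mul_one, Complex.norm_real, Complex.norm_real,
          Real.norm_of_nonneg (hp0 m), Real.norm_of_nonneg (fockDensity_nonneg m r)]
      simp_rw [this, integral_const_mul, integral_fockDensity, mul_one]
      exact hp)
  simp_rw [integral_const_mul] at h
  convert! h using 3 with r
  simp_rw [← mul_assoc]
  rw [tsum_mul_right, Complex.ofReal_tsum]
  push_cast
  rfl

/-- The characteristic function of `T(W)` for `W` concentrated at `m` is a Laguerre function.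
Both sides have the same generating function, because the geometric mixtures of Fock densities
are Gaussian. -/
theorem integral_fockDensity_mul_planeChar (m : ℕ) (s : ℂ) :
    ∫ r, (fockDensity m r : ℂ) * planeChar s r = (laguerreExp m (‖s‖ ^ 2) : ℂ) := by
  have key := eq_zero_of_hasSum_pow_smul (a := fun m =>
    (∫ r, (fockDensity m r : ℂ) * planeChar s r) - (laguerreExp m (‖s‖ ^ 2) : ℂ)) ?_ m
  · exact sub_eq_zero.1 key
  intro u hu
  have hu1 : 0 < 1 - u := by linarith [hu.2]
  have h1 := hasSum_integral_fockDensity (p := fun m => u ^ m) (fun m => pow_nonneg hu.1.le m)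
    (summable_geometric_of_lt_one hu.1.le hu.2) s
  have h2 : ∀ r : ℂ, ∑' m, u ^ m * fockDensity m r =
      Real.pi⁻¹ * Real.exp (-(1 - u) * ‖r‖ ^ 2) := by
    intro r
    have h := NormedSpace.expSeries_div_hasSum_exp (𝔸 := ℝ) (u * ‖r‖ ^ 2)
    rw [← Real.exp_eq_exp_ℝ] at h
    have h' := h.mul_left (Real.pi⁻¹ * Real.exp (-‖r‖ ^ 2))
    rw [mul_assoc, ← Real.exp_add, show -‖r‖ ^ 2 + u * ‖r‖ ^ 2 = -(1 - u) * ‖r‖ ^ 2 by ring] at h'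
    rw [← h'.tsum_eq]
    refine tsum_congr fun m => ?_
    rw [fockDensity, mul_pow, pow_mul]
    field_simp
  simp_rw [h2] at h1
  have h3 : (∫ r, ((Real.pi⁻¹ * Real.exp (-(1 - u) * ‖r‖ ^ 2) : ℝ) : ℂ) * planeChar s r) =
      ((Real.exp (-‖s‖ ^ 2 / (1 - u)) / (1 - u) : ℝ) : ℂ) := by
    simp_rw [Complex.ofReal_mul, mul_assoc, integral_const_mul,
      integral_gaussian_mul_planeChar hu1 s]
    rw [← Complex.ofReal_mul, inv_mul_cancel_left₀ Real.pi_ne_zero]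
  rw [h3] at h1
  have h4 := (hasSum_laguerreExp_generating ⟨hu.1.le, hu.2⟩ (‖s‖ ^ 2))
  have h5 := h1.sub (Complex.hasSum_ofReal.2 h4)
  rw [sub_self] at h5
  convert! h5 using 2 with m
  rw [Complex.real_smul]
  push_cast
  ring

theorem abs_laguerreExp_le_one (m : ℕ) {x : ℝ} (hx : 0 ≤ x) : |laguerreExp m x| ≤ 1 := by
  have h := integral_fockDensity_mul_planeChar m (Real.sqrt x)
  rw [Complex.norm_real, Real.norm_of_nonneg (Real.sqrt_nonneg x), Real.sq_sqrt hx] at h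
  rw [← Real.norm_eq_abs, ← Complex.norm_real, ← h]
  refine (norm_integral_le_integral_norm _).trans_eq ?_
  rw [← integral_fockDensity m]
  congr 1
  ext r
  rw [norm_mul, norm_planeChar, mul_one, Complex.norm_real,
    Real.norm_of_nonneg (fockDensity_nonneg m r)]

theorem summable_mul_laguerreExp {p : ℕ → ℝ} (hp0 : ∀ m, 0 ≤ p m) (hp : Summable p) {x : ℝ}
    (hx : 0 ≤ x) : Summable fun m => p m * laguerreExp m x := by
  refine hp.of_norm_bounded fun m => ?_
  rw [norm_mul, Real.norm_of_nonneg (hp0 m), Real.norm_eq_abs]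
  exact mul_le_of_le_one_right (hp0 m) (abs_laguerreExp_le_one m hx)

theorem measurable_continuousDensity (p : ℕ → ℝ) : Measurable (continuousDensity p) := by
  unfold continuousDensity
  refine Measurable.tsum fun m => ?_
  exact ((continuous_fockDensity m).measurable.const_mul (p m))

theorem integral_planeChar_continuousLaw {p : ℕ → ℝ} (hp0 : ∀ m, 0 ≤ p m) (hp : Summable p)
    (s : ℂ) : ∫ r, planeChar s r ∂(continuousLaw p) =
      ((∑' m, p m * laguerreExp m (‖s‖ ^ 2) : ℝ) : ℂ) := by
  have hnn : ∀ r, 0 ≤ continuousDensity p r := fun r =>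
    tsum_nonneg fun m => mul_nonneg (hp0 m) (fockDensity_nonneg m r)
  rw [continuousLaw, integral_withDensity_eq_integral_toReal_smul
    (measurable_continuousDensity p).ennreal_ofReal (by simp)]
  have h := hasSum_integral_fockDensity hp0 hp s
  simp_rw [integral_fockDensity_mul_planeChar] at h
  rw [Complex.ofReal_tsum]
  push_cast
  rw [h.tsum_eq]
  congr 1
  ext r
  rw [ENNReal.toReal_ofReal (hnn r), Complex.real_smul]
  rfl

instance (p : ℕ → ℝ) : SFinite (continuousLaw p) := by
  unfold continuousLaw; infer_instance

theorem integral_planeChar_mixedLaw (η : ℝ) (μ ν : Measure ℂ) [SFinite μ] [SFinite ν] (s : ℂ) :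
    ∫ r, planeChar s r ∂(mixedLaw η μ ν) =
      (∫ r, planeChar (Real.sqrt η * s) r ∂μ) * ∫ r, planeChar (Real.sqrt (1 - η) * s) r ∂ν := by
  rw [mixedLaw, integral_map (by fun_prop) (continuous_planeChar s).aestronglyMeasurable]
  simp_rw [planeChar_add, planeChar_ofReal_mul]
  exact integral_prod_mul _ _

/-- `T⁻¹` recovers the mass function `p` from the characteristic function of `T`. The sum and the
integral may be exchanged since `2 |L_m L_n| ≤ L_m² + L_n²` gives a bound independent of `m`. -/
theorem inverseMap_eq {p : ℕ → ℝ} (hp0 : ∀ m, 0 ≤ p m) (hp : Summable p) {ν : Measure ℂ}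
    (hν : ∀ s, ∫ r, planeChar s r ∂ν = ((∑' m, p m * laguerreExp m (‖s‖ ^ 2) : ℝ) : ℂ)) (n : ℕ) :
    inverseMap ν n = p n := by
  have hsum := hasSum_integral_of_summable_integral_norm
    (F := fun (m : ℕ) (s : ℂ) => p m * (laguerreExp m (‖s‖ ^ 2) * laguerre n (‖s‖ ^ 2)))
    (μ := volume) (fun m => (integral_laguerreExp_mul_laguerre m n).1.const_mul _) (by
      refine Summable.of_nonneg_of_le (fun m => integral_nonneg fun s => norm_nonneg _)
        (fun m => ?_) (hp.mul_right Real.pi)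
      simp_rw [norm_mul (p m), integral_const_mul, Real.norm_of_nonneg (hp0 m)]
      refine mul_le_mul_of_nonneg_left ?_ (hp0 m)
      have hm := integral_laguerreExp_mul_laguerre m m
      have hn := integral_laguerreExp_mul_laguerre n n
      have hle := integral_mono (integral_laguerreExp_mul_laguerre m n).1.norm
        ((hm.1.add hn.1).const_mul (1 / 2)) (fun s => by
          simp only [laguerreExp, Pi.add_apply, norm_mul, Real.norm_eq_abs, Real.abs_exp]
          have h1 := two_mul_le_add_sq |laguerre m (‖s‖ ^ 2)| |laguerre n (‖s‖ ^ 2)|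
          rw [sq_abs, sq_abs] at h1
          have h2 := mul_le_mul_of_nonneg_left h1 (Real.exp_pos (-‖s‖ ^ 2)).le
          linarith)
      rw [integral_const_mul] at hle
      simp only [Pi.add_apply] at hle
      rw [integral_add hm.1 hn.1, hm.2, hn.2, if_pos rfl, if_pos rfl] at hle
      linarith)
  simp_rw [integral_const_mul, (integral_laguerreExp_mul_laguerre _ n).2] at hsum
  have hone : HasSum (fun m => p m * if m = n then Real.pi else 0) (p n * Real.pi) := by
    convert! hasSum_ite_eq n (p n * Real.pi) using 2 with m
    split_ifs with h <;> simp [h]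
  have h := hone.unique hsum
  have hinner : ∀ s : ℂ, (∫ r : ℂ, Complex.exp (r * (starRingEnd ℂ) s - (starRingEnd ℂ) r * s) ∂ν)
      * (laguerre n (‖s‖ ^ 2) : ℂ) =
      ((∑' m, p m * (laguerreExp m (‖s‖ ^ 2) * laguerre n (‖s‖ ^ 2)) : ℝ) : ℂ) := by
    intro s
    have := hν s
    simp only [planeChar] at this
    rw [this, ← Complex.ofReal_mul, ← tsum_mul_right]
    simp_rw [mul_assoc]
  rw [inverseMap]
  simp_rw [hinner]
  rw [integral_complex_ofReal, ← h, ← Complex.ofReal_one, ← Complex.ofReal_div,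
    ← Complex.ofReal_mul, Complex.ofReal_re]
  field_simp

/-! ### The transition kernel as a family of power series -/

/-- A real power series converges absolutely at `1`, with sum `v`. -/
def HasAbsSum (f : PowerSeries ℝ) (v : ℝ) : Prop :=
  (Summable fun n => ‖PowerSeries.coeff n f‖) ∧ HasSum (fun n => PowerSeries.coeff n f) v

theorem HasAbsSum.mul {f g : PowerSeries ℝ} {v w : ℝ} (hf : HasAbsSum f v) (hg : HasAbsSum g w) :
    HasAbsSum (f * g) (v * w) := by
  have h1 := summable_norm_sum_mul_antidiagonal_of_summable_norm hf.1 hg.1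
  have h2 := tsum_mul_tsum_eq_tsum_sum_antidiagonal_of_summable_norm hf.1 hg.1
  simp_rw [← PowerSeries.coeff_mul] at h1 h2
  refine ⟨h1, ?_⟩
  rw [← hf.2.tsum_eq, ← hg.2.tsum_eq, h2]
  exact h1.of_norm.hasSum

theorem HasAbsSum.add {f g : PowerSeries ℝ} {v w : ℝ} (hf : HasAbsSum f v) (hg : HasAbsSum g w) :
    HasAbsSum (f + g) (v + w) := by
  refine ⟨?_, ?_⟩
  · refine (hf.1.add hg.1).of_nonneg_of_le (fun _ => norm_nonneg _) fun n => ?_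
    rw [map_add]
    exact norm_add_le _ _
  · simpa only [map_add] using hf.2.add hg.2

theorem hasAbsSum_C (a : ℝ) : HasAbsSum (PowerSeries.C a) a := by
  have h : ∀ n, PowerSeries.coeff n (PowerSeries.C a) = if n = 0 then a else 0 := fun n =>
    PowerSeries.coeff_C n a
  refine ⟨?_, ?_⟩
  · refine summable_of_ne_finset_zero (s := {0}) fun n hn => ?_
    simp_all
  · simp_rw [h]
    exact hasSum_ite_eq 0 a

theorem hasAbsSum_X : HasAbsSum PowerSeries.X 1 := by
  have h : ∀ n, PowerSeries.coeff n (PowerSeries.X : PowerSeries ℝ) = if n = 1 then 1 else 0 :=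
    fun n => PowerSeries.coeff_X n
  refine ⟨?_, ?_⟩
  · refine summable_of_ne_finset_zero (s := {1}) fun n hn => ?_
    simp_all
  · simp_rw [h]
    exact hasSum_ite_eq 1 1

theorem HasAbsSum.pow {f : PowerSeries ℝ} {v : ℝ} (hf : HasAbsSum f v) (m : ℕ) :
    HasAbsSum (f ^ m) (v ^ m) := by
  induction m with
  | zero => simpa using hasAbsSum_C 1
  | succ m ih => simpa only [pow_succ] using ih.mul hf

theorem coeff_mul_nonneg {f g : PowerSeries ℝ} (hf : ∀ n, 0 ≤ PowerSeries.coeff n f)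
    (hg : ∀ n, 0 ≤ PowerSeries.coeff n g) (n : ℕ) : 0 ≤ PowerSeries.coeff n (f * g) := by
  rw [PowerSeries.coeff_mul]
  exact Finset.sum_nonneg fun q _ => mul_nonneg (hf _) (hg _)

theorem coeff_pow_nonneg {f : PowerSeries ℝ} (hf : ∀ n, 0 ≤ PowerSeries.coeff n f) (m n : ℕ) :
    0 ≤ PowerSeries.coeff n (f ^ m) := by
  induction m generalizing n with
  | zero =>
    rw [pow_zero, PowerSeries.coeff_one]
    split_ifs <;> norm_num
  | succ m ih => exact pow_succ f m ▸ coeff_mul_nonneg ih hf n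

/-- The affine series `a + b X`. -/
noncomputable def affine (a b : ℝ) : PowerSeries ℝ :=
  PowerSeries.C a + PowerSeries.C b * PowerSeries.X

theorem coeff_zero_affine_mul (a b : ℝ) (f : PowerSeries ℝ) :
    PowerSeries.coeff 0 (affine a b * f) = a * PowerSeries.coeff 0 f := by
  simp [affine]

theorem coeff_succ_affine_mul (a b : ℝ) (f : PowerSeries ℝ) (n : ℕ) :
    PowerSeries.coeff (n + 1) (affine a b * f) =
      a * PowerSeries.coeff (n + 1) f + b * PowerSeries.coeff n f := by
  rw [affine, add_mul, map_add, PowerSeries.coeff_C_mul, mul_assoc, PowerSeries.coeff_C_mul,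
    PowerSeries.coeff_succ_X_mul]

theorem hasAbsSum_affine (a b : ℝ) : HasAbsSum (affine a b) (a + b) := by
  have h := (hasAbsSum_C a).add ((hasAbsSum_C b).mul hasAbsSum_X)
  rwa [mul_one] at h

/-- The generating series `(1 + κ - κ X)⁻¹` of the geometric law with mean `κ`. -/
noncomputable def geomSeries (κ : ℝ) : PowerSeries ℝ :=
  PowerSeries.mk fun n => κ ^ n / (1 + κ) ^ (n + 1)

theorem affine_mul_geomSeries {κ : ℝ} (hκ : 1 + κ ≠ 0) :
    affine (1 + κ) (-κ) * geomSeries κ = 1 := by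
  ext n
  cases n with
  | zero =>
    rw [coeff_zero_affine_mul, geomSeries, PowerSeries.coeff_mk]
    simp [hκ]
  | succ n =>
    rw [coeff_succ_affine_mul, geomSeries, PowerSeries.coeff_mk, PowerSeries.coeff_mk,
      PowerSeries.coeff_one, if_neg n.succ_ne_zero]
    field_simp
    ring

theorem hasAbsSum_geomSeries {κ : ℝ} (hκ : 0 ≤ κ) : HasAbsSum (geomSeries κ) 1 := by
  have hs : HasSum (fun n => PowerSeries.coeff n (geomSeries κ)) 1 := by
    have h := (hasSum_geometric_of_lt_one (r := κ / (1 + κ)) (by positivity)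
      ((div_lt_one (by positivity)).2 (by linarith))).mul_left (1 / (1 + κ))
    convert! h using 1
    · ext n
      rw [geomSeries, PowerSeries.coeff_mk, div_pow, pow_succ]
      field_simp
    · field_simp
      ring
  refine ⟨hs.summable.congr fun n => ?_, hs⟩
  rw [Real.norm_of_nonneg]
  rw [geomSeries, PowerSeries.coeff_mk]
  positivity

/-- The generating series `(c + (1 - c) X) ^ m / (1 + κ - κ X) ^ (m + 1)` of the sum of `m`
independent variables with a common linear fractional law and a geometric variable of mean `κ`,
for `0 ≤ κ` and `0 ≤ c ≤ 1 + κ`. -/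
noncomputable def kernelSeries (κ c : ℝ) (m : ℕ) : PowerSeries ℝ :=
  affine c (1 - c) ^ m * geomSeries κ ^ (m + 1)

theorem kernelSeries_coeff_nonneg {κ c : ℝ} (hκ : 0 ≤ κ) (hc : 0 ≤ c) (hcκ : c ≤ 1 + κ)
    (m n : ℕ) : 0 ≤ PowerSeries.coeff n (kernelSeries κ c m) := by
  rw [kernelSeries, pow_succ, ← mul_assoc, ← mul_pow]
  have hg : ∀ n, 0 ≤ PowerSeries.coeff n (geomSeries κ) := fun n => by
    rw [geomSeries, PowerSeries.coeff_mk]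
    positivity
  refine coeff_mul_nonneg (coeff_pow_nonneg (fun n => ?_) m) hg n
  cases n with
  | zero =>
    rw [coeff_zero_affine_mul]
    exact mul_nonneg hc (hg 0)
  | succ n =>
    rw [coeff_succ_affine_mul, geomSeries, PowerSeries.coeff_mk, PowerSeries.coeff_mk]
    have h : c * (κ ^ (n + 1) / (1 + κ) ^ (n + 1 + 1)) + (1 - c) * (κ ^ n / (1 + κ) ^ (n + 1)) =
        κ ^ n * (1 + κ - c) / (1 + κ) ^ (n + 1 + 1) := by
      field_simp
      ring
    rw [h]
    have : 0 ≤ 1 + κ - c := by linarith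
    positivity

theorem hasAbsSum_kernelSeries {κ : ℝ} (hκ : 0 ≤ κ) (c : ℝ) (m : ℕ) :
    HasAbsSum (kernelSeries κ c m) 1 := by
  have h := ((hasAbsSum_affine c (1 - c)).pow m).mul ((hasAbsSum_geomSeries hκ).pow (m + 1))
  rwa [add_sub_cancel, one_pow, one_pow, one_mul] at h

theorem derivative_affine (a b : ℝ) :
    PowerSeries.derivative ℝ (affine a b) = PowerSeries.C b := by
  rw [affine, map_add, PowerSeries.derivative_C, Derivation.leibniz, PowerSeries.derivative_C,
    PowerSeries.derivative_X]
  simp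

theorem derivative_geomSeries {κ : ℝ} (hκ : 1 + κ ≠ 0) :
    PowerSeries.derivative ℝ (geomSeries κ) = PowerSeries.C κ * geomSeries κ ^ 2 := by
  have h := affine_mul_geomSeries hκ
  have hd := congrArg (PowerSeries.derivative ℝ) h
  rw [Derivation.leibniz, derivative_affine, Derivation.map_one_eq_zero, map_neg, smul_eq_mul,
    smul_eq_mul] at hd
  linear_combination geomSeries κ * hd - PowerSeries.derivative ℝ (geomSeries κ) * h

theorem derivative_kernelSeries {κ : ℝ} (hκ : 1 + κ ≠ 0) (c : ℝ) (m : ℕ) :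
    PowerSeries.derivative ℝ (kernelSeries κ c m) =
      PowerSeries.C (m * (1 - c)) * affine c (1 - c) ^ (m - 1) * geomSeries κ ^ (m + 1) +
      PowerSeries.C ((m + 1) * κ) * affine c (1 - c) ^ m * geomSeries κ ^ (m + 2) := by
  rw [kernelSeries, Derivation.leibniz, Derivation.leibniz_pow, Derivation.leibniz_pow,
    derivative_affine, derivative_geomSeries hκ]
  simp only [smul_eq_mul, nsmul_eq_mul, map_mul, map_add, map_natCast, map_one, Nat.cast_add,
    Nat.cast_one, Nat.add_sub_cancel]
  ring

theorem hasSum_mul_coeff_kernelSeries {κ : ℝ} (hκ : 0 ≤ κ) (c : ℝ) (m : ℕ) :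
    HasSum (fun n : ℕ => n * PowerSeries.coeff n (kernelSeries κ c m))
      ((1 - c + κ) * m + κ) := by
  have hA := hasAbsSum_affine c (1 - c)
  have hG := hasAbsSum_geomSeries hκ
  have h := (((hasAbsSum_C (m * (1 - c))).mul (hA.pow (m - 1))).mul (hG.pow (m + 1))).add
    (((hasAbsSum_C ((m + 1) * κ)).mul (hA.pow m)).mul (hG.pow (m + 2)))
  rw [← derivative_kernelSeries (by positivity)] at h
  refine (hasSum_nat_add_iff' 1).1 ?_
  convert! h.2 using 1
  · ext n
    rw [PowerSeries.coeff_derivative]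
    push_cast
    ring
  · simp
    ring

theorem coeff_kernelSeries_le_one {κ c : ℝ} (hκ : 0 ≤ κ) (hc : 0 ≤ c) (hcκ : c ≤ 1 + κ)
    (m n : ℕ) : PowerSeries.coeff n (kernelSeries κ c m) ≤ 1 :=
  le_hasSum (hasAbsSum_kernelSeries hκ c m).2 n fun _ _ => kernelSeries_coeff_nonneg hκ hc hcκ _ _

theorem affine_mul_kernelSeries_zero {κ : ℝ} (hκ : 1 + κ ≠ 0) (c : ℝ) :
    affine (1 + κ) (-κ) * kernelSeries κ c 0 = 1 := by
  rw [kernelSeries, pow_zero, one_mul, zero_add, pow_one, affine_mul_geomSeries hκ]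

/-- The recurrence of the kernel in its first variable, cleared of denominators. -/
theorem affine_mul_kernelSeries_succ {κ : ℝ} (hκ : 1 + κ ≠ 0) (c : ℝ) (m : ℕ) :
    affine (1 + κ) (-κ) * kernelSeries κ c (m + 1) = affine c (1 - c) * kernelSeries κ c m := by
  have h := affine_mul_geomSeries hκ
  rw [kernelSeries, kernelSeries]
  linear_combination affine c (1 - c) ^ (m + 1) * geomSeries κ ^ (m + 1) * h

/-- Summing the kernel against a geometric weight in its first variable gives a geometric sequence
in the second. -/
theorem hasSum_pow_mul_coeff_kernelSeries {κ c u : ℝ} (hκ : 0 ≤ κ) (hc : 0 ≤ c) (hcκ : c ≤ 1 + κ)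
    (hu : u ∈ Set.Ico (0 : ℝ) 1) (n : ℕ) :
    HasSum (fun m => u ^ m * PowerSeries.coeff n (kernelSeries κ c m))
      (((κ + u * (1 - c)) / (1 + κ - u * c)) ^ n * (1 / (1 + κ - u * c))) := by
  have hs : ∀ n, Summable fun m => u ^ m * PowerSeries.coeff n (kernelSeries κ c m) := by
    intro n
    refine (summable_geometric_of_lt_one hu.1 hu.2).of_nonneg_of_le (fun m => ?_) fun m => ?_
    · exact mul_nonneg (pow_nonneg hu.1 m) (kernelSeries_coeff_nonneg hκ hc hcκ m n)
    · exact mul_le_of_le_one_right (pow_nonneg hu.1 m) (coeff_kernelSeries_le_one hκ hc hcκ m n)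
  have hd : 1 + κ - u * c ≠ 0 := by
    have h1 : u * c ≤ u * (1 + κ) := mul_le_mul_of_nonneg_left hcκ hu.1
    have h2 : u * (1 + κ) < 1 * (1 + κ) := mul_lt_mul_of_pos_right hu.2 (by positivity)
    linarith
  have hκ' : 1 + κ ≠ 0 := by positivity
  induction n with
  | zero =>
    have h1 := ((hs 0).hasSum.mul_left (1 + κ)).tsum_eq
    have h2 : ∀ m, (1 + κ) * (u ^ m * PowerSeries.coeff 0 (kernelSeries κ c m)) =
        u ^ m * PowerSeries.coeff 0 (affine (1 + κ) (-κ) * kernelSeries κ c m) := fun m => by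
      rw [coeff_zero_affine_mul]
      ring
    rw [((hs 0).mul_left (1 + κ)).tsum_eq_zero_add] at h1
    simp_rw [h2, affine_mul_kernelSeries_zero hκ', affine_mul_kernelSeries_succ hκ',
      coeff_zero_affine_mul, pow_succ] at h1
    have h3 : ∀ m, u ^ m * u * (c * PowerSeries.coeff 0 (kernelSeries κ c m)) =
        u * c * (u ^ m * PowerSeries.coeff 0 (kernelSeries κ c m)) := fun m => by ring
    simp_rw [h3, tsum_mul_left] at h1
    rw [PowerSeries.coeff_zero_one, pow_zero, one_mul] at h1
    rw [pow_zero, one_mul]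
    convert! (hs 0).hasSum using 1
    rw [div_eq_iff hd]
    linear_combination h1
  | succ n ih =>
    have hsum := ((hs (n + 1)).mul_left (1 + κ)).add ((hs n).mul_left (-κ))
    have h1 := (((hs (n + 1)).hasSum.mul_left (1 + κ)).add ((hs n).hasSum.mul_left (-κ))).tsum_eq
    have h2 : ∀ m, (1 + κ) * (u ^ m * PowerSeries.coeff (n + 1) (kernelSeries κ c m)) +
        -κ * (u ^ m * PowerSeries.coeff n (kernelSeries κ c m)) =
        u ^ m * PowerSeries.coeff (n + 1) (affine (1 + κ) (-κ) * kernelSeries κ c m) := fun m => by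
      rw [coeff_succ_affine_mul]
      ring
    rw [hsum.tsum_eq_zero_add] at h1
    simp_rw [h2, affine_mul_kernelSeries_zero hκ', affine_mul_kernelSeries_succ hκ',
      coeff_succ_affine_mul, pow_succ] at h1
    have h3 : ∀ m, u ^ m * u * (c * PowerSeries.coeff (n + 1) (kernelSeries κ c m) +
        (1 - c) * PowerSeries.coeff n (kernelSeries κ c m)) =
        u * c * (u ^ m * PowerSeries.coeff (n + 1) (kernelSeries κ c m)) +
        u * (1 - c) * (u ^ m * PowerSeries.coeff n (kernelSeries κ c m)) := fun m => by ring
    simp_rw [h3] at h1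
    rw [((hs (n + 1)).mul_left _).tsum_add ((hs n).mul_left _), tsum_mul_left, tsum_mul_left,
      PowerSeries.coeff_one, if_neg n.succ_ne_zero, mul_zero, ih.tsum_eq] at h1
    convert! (hs (n + 1)).hasSum using 1
    rw [pow_succ]
    set q := ((κ + u * (1 - c)) / (1 + κ - u * c)) ^ n
    set S := ∑' m, u ^ m * PowerSeries.coeff (n + 1) (kernelSeries κ c m)
    have h4 : (1 + κ - u * c) * S = (κ + u * (1 - c)) * (q * (1 / (1 + κ - u * c))) := by
      linear_combination -h1
    rw [← mul_right_inj' hd, h4]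
    field_simp

/-- The Laguerre functions are carried to Laguerre functions by the kernel. Both sides have the
same generating function in `m`. -/
theorem hasSum_coeff_kernelSeries_mul_laguerreExp {κ c : ℝ} (hκ : 0 ≤ κ) (hc : 0 ≤ c)
    (hcκ : c ≤ 1 + κ) {x : ℝ} (hx : 0 ≤ x) (m : ℕ) :
    HasSum (fun n => PowerSeries.coeff n (kernelSeries κ c m) * laguerreExp n x)
      (laguerreExp m ((1 + κ - c) * x) * Real.exp (-c * x)) := by
  have hk0 := kernelSeries_coeff_nonneg hκ hc hcκ
  have hsm : ∀ m, Summable fun n => PowerSeries.coeff n (kernelSeries κ c m) * laguerreExp n x :=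
    fun m => summable_mul_laguerreExp (hk0 m) (hasAbsSum_kernelSeries hκ c m).2.summable hx
  have key := eq_zero_of_hasSum_pow_smul (a := fun m =>
    (∑' n, PowerSeries.coeff n (kernelSeries κ c m) * laguerreExp n x) -
      laguerreExp m ((1 + κ - c) * x) * Real.exp (-c * x)) ?_ m
  · rw [← sub_eq_zero.1 key]
    exact (hsm m).hasSum
  intro u hu
  have hu' : u ∈ Set.Ico (0 : ℝ) 1 := ⟨hu.1.le, hu.2⟩
  have hu1 : 0 < 1 - u := by linarith [hu.2]
  have hd : 0 < 1 + κ - u * c := by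
    have h1 : u * c ≤ u * (1 + κ) := mul_le_mul_of_nonneg_left hcκ hu.1.le
    have h2 : u * (1 + κ) < 1 * (1 + κ) := mul_lt_mul_of_pos_right hu.2 (by positivity)
    linarith
  have hn : 0 ≤ κ + u * (1 - c) := by
    have h1 : u * c ≤ u * (1 + κ) := mul_le_mul_of_nonneg_left hcκ hu.1.le
    nlinarith
  have hq : (κ + u * (1 - c)) / (1 + κ - u * c) ∈ Set.Ico (0 : ℝ) 1 :=
    ⟨by positivity, (div_lt_one hd).2 (by linarith)⟩
  have hq1 : 1 - (κ + u * (1 - c)) / (1 + κ - u * c) = (1 - u) / (1 + κ - u * c) := by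
    field_simp
    ring
  let f : ℕ × ℕ → ℝ := fun i =>
    u ^ i.1 * (PowerSeries.coeff i.2 (kernelSeries κ c i.1) * laguerreExp i.2 x)
  have hf0 : 0 ≤ fun i : ℕ × ℕ =>
      u ^ i.1 * PowerSeries.coeff i.2 (kernelSeries κ c i.1) := fun i =>
    mul_nonneg (pow_nonneg hu.1.le i.1) (hk0 i.1 i.2)
  have hf : Summable f := by
    have hnn : Summable fun i : ℕ × ℕ =>
        u ^ i.1 * PowerSeries.coeff i.2 (kernelSeries κ c i.1) := by
      refine (summable_prod_of_nonneg hf0).2 ⟨fun m => ?_, ?_⟩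
      · exact (hasAbsSum_kernelSeries hκ c m).2.summable.mul_left (u ^ m)
      · simp_rw [tsum_mul_left, (hasAbsSum_kernelSeries hκ c _).2.tsum_eq, mul_one]
        exact summable_geometric_of_lt_one hu.1.le hu.2
    refine hnn.of_norm_bounded fun i => ?_
    simp only [f]
    rw [← mul_assoc, norm_mul, Real.norm_of_nonneg (hf0 i), Real.norm_eq_abs]
    exact mul_le_of_le_one_right (hf0 i) (abs_laguerreExp_le_one _ hx)
  have h1 := hf.hasSum.prod_fiberwise fun m => (hsm m).hasSum.mul_left (u ^ m)
  have h2 := ((Equiv.prodComm ℕ ℕ).hasSum_iff.2 hf.hasSum).prod_fiberwise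
    (g := fun n => ((κ + u * (1 - c)) / (1 + κ - u * c)) ^ n * (1 / (1 + κ - u * c)) *
      laguerreExp n x) fun n => by
    convert! (hasSum_pow_mul_coeff_kernelSeries hκ hc hcκ hu' n).mul_right (laguerreExp n x) using 2
      with m
    simp only [f, Function.comp, Equiv.prodComm_apply, Prod.swap]
    ring
  have h3 := (hasSum_laguerreExp_generating hq x).mul_left (1 / (1 + κ - u * c))
  have h4 : (1 / (1 + κ - u * c)) *
      (Real.exp (-x / (1 - (κ + u * (1 - c)) / (1 + κ - u * c))) /
        (1 - (κ + u * (1 - c)) / (1 + κ - u * c))) =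
      Real.exp (-((1 + κ - c) * x) / (1 - u)) / (1 - u) * Real.exp (-c * x) := by
    rw [hq1, div_mul_eq_mul_div (Real.exp _) (1 - u), ← Real.exp_add,
      show -x / ((1 - u) / (1 + κ - u * c)) = -((1 + κ - c) * x) / (1 - u) + -c * x by
        field_simp
        ring]
    field_simp
  have h5 : ∑' i, f i =
      Real.exp (-((1 + κ - c) * x) / (1 - u)) / (1 - u) * Real.exp (-c * x) := by
    rw [← h4]
    refine h2.unique ?_
    convert! h3 using 2 with n
    ring
  have h6 := (hasSum_laguerreExp_generating hu' ((1 + κ - c) * x)).mul_right (Real.exp (-c * x))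
  rw [h5] at h1
  have h7 := h1.sub h6
  rw [sub_self] at h7
  convert! h7 using 2 with m
  rw [smul_eq_mul]
  ring

/-! ### Mixtures of a kernel -/

/-- Expectations under a mixture of the laws `k m`. The function `b` dominates `g` and supplies the
absolute convergence needed to exchange the sums. -/
theorem hasSum_mixture {p : ℕ → ℝ} (hp0 : ∀ m, 0 ≤ p m) (hp : Summable p) {k : ℕ → ℕ → ℝ}
    (hk0 : ∀ m n, 0 ≤ k m n) (hk1 : ∀ m n, k m n ≤ 1) {g b G B : ℕ → ℝ} (hgb : ∀ n, |g n| ≤ b n)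
    (hG : ∀ m, HasSum (fun n => k m n * g n) (G m)) (hB : ∀ m, HasSum (fun n => k m n * b n) (B m))
    (hpB : Summable fun m => p m * B m) :
    HasSum (fun n => (∑' m, p m * k m n) * g n) (∑' m, p m * G m) := by
  let f : ℕ × ℕ → ℝ := fun i => p i.1 * (k i.1 i.2 * g i.2)
  have hb : ∀ n, 0 ≤ b n := fun n => (abs_nonneg _).trans (hgb n)
  have hf : Summable f := by
    have hnn : Summable fun i : ℕ × ℕ => p i.1 * (k i.1 i.2 * b i.2) := by
      refine (summable_prod_of_nonneg fun i =>
        mul_nonneg (hp0 i.1) (mul_nonneg (hk0 i.1 i.2) (hb i.2))).2 ⟨fun m => ?_, ?_⟩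
      · exact ((hB m).mul_left (p m)).summable
      · simp_rw [tsum_mul_left, (hB _).tsum_eq]
        exact hpB
    refine hnn.of_norm_bounded fun i => ?_
    simp only [f, norm_mul, Real.norm_of_nonneg (hp0 i.1), Real.norm_of_nonneg (hk0 i.1 i.2),
      Real.norm_eq_abs (g i.2)]
    exact mul_le_mul_of_nonneg_left (mul_le_mul_of_nonneg_left (hgb _) (hk0 _ _)) (hp0 _)
  have h1 := hf.hasSum.prod_fiberwise fun m => (hG m).mul_left (p m)
  have h2 := ((Equiv.prodComm ℕ ℕ).hasSum_iff.2 hf.hasSum).prod_fiberwise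
    (g := fun n => (∑' m, p m * k m n) * g n) fun n => by
    have hs : Summable fun m => p m * k m n := hp.of_nonneg_of_le
      (fun m => mul_nonneg (hp0 m) (hk0 m n)) fun m => mul_le_of_le_one_right (hp0 m) (hk1 m n)
    convert! hs.hasSum.mul_right (g n) using 2 with m
    simp only [f, Function.comp, Equiv.prodComm_apply, Prod.swap]
    ring
  rwa [h1.tsum_eq]

/-- Term-by-term differentiation relative to a convex set, which may contain its endpoints: the
slopes of the terms are dominated by the bounds on the derivatives. -/
theorem hasDerivWithinAt_tsum_of_bounded {s : Set ℝ} (hs : Convex ℝ s) {f f' : ℕ → ℝ → ℝ}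
    {C : ℕ → ℝ} (hC : Summable C) (hf : ∀ m, ∀ t ∈ s, HasDerivWithinAt (f m) (f' m t) s t)
    (hf' : ∀ m, ∀ t ∈ s, ‖f' m t‖ ≤ C m) (hsum : ∀ t ∈ s, Summable fun m => f m t) {t : ℝ}
    (ht : t ∈ s) : HasDerivWithinAt (fun x => ∑' m, f m x) (∑' m, f' m t) s t := by
  rw [hasDerivWithinAt_iff_tendsto_slope]
  have hlim : Filter.Tendsto (fun x => ∑' m, slope (f m) t x) (nhdsWithin t (s \ {t}))
      (nhds (∑' m, f' m t)) := by
    refine tendsto_tsum_of_dominated_convergence hC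
      (fun m => hasDerivWithinAt_iff_tendsto_slope.1 (hf m t ht)) ?_
    filter_upwards [self_mem_nhdsWithin] with x hx m
    have h := hs.norm_image_sub_le_of_norm_hasDerivWithin_le (hf m) (hf' m) ht hx.1
    rw [slope_def_field, norm_div]
    exact div_le_of_le_mul₀ (norm_nonneg _) ((norm_nonneg _).trans (hf' m t ht)) h
  refine hlim.congr' ?_
  filter_upwards [self_mem_nhdsWithin] with x hx
  simp_rw [slope_def_field]
  rw [tsum_div_const, (hsum x hx.1).tsum_sub (hsum t ht)]

/-! ### The forward equation of the kernel -/

/-- The power series `F'` is the derivative of the family `F` at `t`, coefficient by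
coefficient. -/
def HasCoeffDerivAt (F : ℝ → PowerSeries ℝ) (F' : PowerSeries ℝ) (t : ℝ) : Prop :=
  ∀ n, HasDerivAt (fun x => PowerSeries.coeff n (F x)) (PowerSeries.coeff n F') t

theorem HasCoeffDerivAt.mul {F G : ℝ → PowerSeries ℝ} {F' G' : PowerSeries ℝ} {t : ℝ}
    (hF : HasCoeffDerivAt F F' t) (hG : HasCoeffDerivAt G G' t) :
    HasCoeffDerivAt (fun x => F x * G x) (F' * G t + F t * G') t := by
  intro n
  simp_rw [map_add, PowerSeries.coeff_mul, ← Finset.sum_add_distrib]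
  exact HasDerivAt.fun_sum fun q _ => (hF q.1).mul (hG q.2)

theorem HasCoeffDerivAt.pow {F : ℝ → PowerSeries ℝ} {F' : PowerSeries ℝ} {t : ℝ}
    (hF : HasCoeffDerivAt F F' t) (m : ℕ) :
    HasCoeffDerivAt (fun x => F x ^ m) (m * F t ^ (m - 1) * F') t := by
  induction m with
  | zero =>
    intro n
    simpa using hasDerivAt_const t _
  | succ m ih =>
    have h := ih.mul hF
    simp_rw [← pow_succ] at h
    convert! h using 1
    cases m with
    | zero => simp
    | succ m =>
      simp only [Nat.add_sub_cancel]
      push_cast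
      ring

theorem hasCoeffDerivAt_affine {a b : ℝ → ℝ} {a' b' t : ℝ} (ha : HasDerivAt a a' t)
    (hb : HasDerivAt b b' t) :
    HasCoeffDerivAt (fun x => affine (a x) (b x)) (affine a' b') t := by
  intro n
  have h : ∀ a b : ℝ, PowerSeries.coeff n (affine a b) =
      a * PowerSeries.coeff n 1 + b * PowerSeries.coeff n PowerSeries.X := fun a b => by
    rw [affine, map_add, PowerSeries.coeff_C_mul, ← PowerSeries.coeff_C_mul n 1 a, mul_one]
  simp_rw [h]
  exact (ha.mul_const _).add (hb.mul_const _)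

theorem hasCoeffDerivAt_geomSeries {κ : ℝ → ℝ} {κ' t : ℝ} (hκ : HasDerivAt κ κ' t)
    (h0 : 1 + κ t ≠ 0) : HasCoeffDerivAt (fun x => geomSeries (κ x))
      (affine (-κ') κ' * geomSeries (κ t) ^ 2) t := by
  obtain ⟨G', hG'⟩ : ∃ G', HasCoeffDerivAt (fun x => geomSeries (κ x)) G' t := by
    have h : ∀ n, ∃ d, HasDerivAt (fun x => κ x ^ n / (1 + κ x) ^ (n + 1)) d t := fun n =>
      ⟨_, (hκ.pow n).div ((hκ.const_add 1).pow (n + 1)) (pow_ne_zero _ h0)⟩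
    choose d hd using h
    refine ⟨PowerSeries.mk d, fun n => ?_⟩
    simp_rw [geomSeries, PowerSeries.coeff_mk]
    exact hd n
  -- differentiating the identity `(1 + κ - κ X) * geomSeries κ = 1` determines `G'`
  have hprod := (hasCoeffDerivAt_affine (hκ.const_add 1) hκ.neg).mul hG'
  have hzero : affine κ' (-κ') * geomSeries (κ t) +
      affine (1 + κ t) (-κ t) * G' = 0 := by
    ext n
    have hev : ∀ᶠ x in nhds t, 1 + κ x ≠ 0 := (hκ.const_add 1).continuousAt.eventually_ne h0
    refine (hprod n).unique ?_
    refine (hasDerivAt_const t (PowerSeries.coeff n (1 : PowerSeries ℝ))).congr_of_eventuallyEq ?_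
    filter_upwards [hev] with x hx
    rw [Pi.neg_apply, affine_mul_geomSeries hx]
  have h1 := affine_mul_geomSeries h0
  have hG : G' = affine (-κ') κ' * geomSeries (κ t) ^ 2 := by
    simp only [affine, map_neg] at hzero h1 ⊢
    linear_combination geomSeries (κ t) * hzero - G' * h1
  rwa [← hG]

/-- The generating series of the law of `X ⊞_η Y` when `X` is concentrated at `m` and `Y` is
geometric of mean `lam`. -/
noncomputable def beamsplitterSeries (lam η : ℝ) (m : ℕ) : PowerSeries ℝ :=
  kernelSeries ((1 - η) * lam) ((1 - η) * (1 + lam)) m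

/-- The first-order partial differential equation
`η ∂_η K = (1 - X) (λ K - (1 + λ - λ X) ∂_X K)` of the generating series, divided by `η`. -/
theorem hasCoeffDerivAt_beamsplitterSeries {lam η : ℝ} (hη : η ≠ 0)
    (h0 : 1 + (1 - η) * lam ≠ 0) (m : ℕ) :
    HasCoeffDerivAt (fun x => beamsplitterSeries lam x m)
      (PowerSeries.C η⁻¹ * (affine 1 (-1) * (PowerSeries.C lam * beamsplitterSeries lam η m +
        affine (-(1 + lam)) lam * PowerSeries.derivative ℝ (beamsplitterSeries lam η m)))) η := by
  have hκ : HasDerivAt (fun x : ℝ => (1 - x) * lam) (-lam) η := by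
    simpa using ((hasDerivAt_id η).const_sub 1).mul_const lam
  have hc : HasDerivAt (fun x : ℝ => (1 - x) * (1 + lam)) (-(1 + lam)) η := by
    simpa using ((hasDerivAt_id η).const_sub 1).mul_const (1 + lam)
  have h := ((hasCoeffDerivAt_affine hc (hc.const_sub 1)).pow m).mul
    ((hasCoeffDerivAt_geomSeries hκ h0).pow (m + 1))
  have hinv : PowerSeries.C η⁻¹ * PowerSeries.C η = 1 := by
    rw [← map_mul, inv_mul_cancel₀ hη, map_one]
  have h1 := affine_mul_geomSeries h0
  unfold beamsplitterSeries
  rw [derivative_kernelSeries h0]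
  unfold kernelSeries
  convert! h using 1
  refine (mul_right_inj' (left_ne_zero_of_mul_eq_one ((mul_comm _ _).trans hinv))).1 ?_
  rw [← mul_assoc, mul_comm (PowerSeries.C η), hinv, one_mul]
  generalize geomSeries ((1 - η) * lam) = g at h1 ⊢
  simp only [affine, map_neg, map_add, map_mul, map_sub, map_one, map_natCast] at h1 ⊢
  generalize PowerSeries.C η = e at h1 ⊢
  generalize PowerSeries.C lam = l at h1 ⊢
  generalize (PowerSeries.X : PowerSeries ℝ) = z at h1 ⊢
  cases m with
  | zero =>
    simp
    linear_combination (-(1 - z) * l * g) * h1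
  | succ m =>
    simp only [Nat.add_sub_cancel, Nat.cast_add, Nat.cast_one]
    rw [pow_succ ((1 - e) * (1 + l) + (1 - (1 - e) * (1 + l)) * z) m]
    generalize ((1 - e) * (1 + l) + (1 - (1 - e) * (1 + l)) * z) ^ m = M
    linear_combination (-(1 - z) * M * ((1 - e) * (1 + l) + (1 - (1 - e) * (1 + l)) * z) * l *
      ((m : PowerSeries ℝ) + 2) * g ^ (m + 2)) * h1

theorem hasDerivAt_coeff_beamsplitterSeries {lam η : ℝ} (hη : η ≠ 0)
    (h0 : 1 + (1 - η) * lam ≠ 0) (m n : ℕ) :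
    HasDerivAt (fun x => PowerSeries.coeff n (beamsplitterSeries lam x m))
      (fwdDiff 1 (fun j : ℕ =>
        (j : ℝ) / η * (PowerSeries.coeff (j - 1) (beamsplitterSeries lam η m) * lam -
          PowerSeries.coeff j (beamsplitterSeries lam η m) * (1 + lam))) n) η := by
  have h := hasCoeffDerivAt_beamsplitterSeries hη h0 m n
  generalize beamsplitterSeries lam η m = K at h
  have hw : ∀ n, PowerSeries.coeff n (PowerSeries.C lam * K +
      affine (-(1 + lam)) lam * PowerSeries.derivative ℝ K) =
      (n + 1) * (PowerSeries.coeff n K * lam - PowerSeries.coeff (n + 1) K * (1 + lam)) := by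
    intro n
    rw [map_add, PowerSeries.coeff_C_mul]
    cases n with
    | zero =>
      rw [coeff_zero_affine_mul, PowerSeries.coeff_derivative]
      push_cast
      ring
    | succ n =>
      rw [coeff_succ_affine_mul, PowerSeries.coeff_derivative, PowerSeries.coeff_derivative]
      push_cast
      ring
  convert! h using 1
  rw [PowerSeries.coeff_C_mul]
  cases n with
  | zero =>
    rw [coeff_zero_affine_mul, hw, fwdDiff]
    simp
  | succ n =>
    rw [coeff_succ_affine_mul, hw, hw, fwdDiff]
    simp only [Nat.add_sub_cancel]
    push_cast
    ring

/-! ### Beamsplitter addition as a mixture of the kernel -/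

section Mixture

variable {p : ℕ → ℝ} {lam η : ℝ}

/-- The mixture over `m`, with weights `p`, of the laws with generating series
`beamsplitterSeries lam η m`. -/
noncomputable def beamsplitterMixture (p : ℕ → ℝ) (lam η : ℝ) (n : ℕ) : ℝ :=
  ∑' m, p m * PowerSeries.coeff n (beamsplitterSeries lam η m)

theorem coeff_beamsplitterSeries_mem_Icc (hlam : 0 ≤ lam) (hη : η ∈ Set.Icc (0 : ℝ) 1) (m n : ℕ) :
    PowerSeries.coeff n (beamsplitterSeries lam η m) ∈ Set.Icc (0 : ℝ) 1 := by
  have h1 : 0 ≤ 1 - η := by linarith [hη.2]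
  have hκ : 0 ≤ (1 - η) * lam := by positivity
  have hc : 0 ≤ (1 - η) * (1 + lam) := by positivity
  have hcκ : (1 - η) * (1 + lam) ≤ 1 + (1 - η) * lam := by linarith [hη.1]
  exact ⟨kernelSeries_coeff_nonneg hκ hc hcκ m n, coeff_kernelSeries_le_one hκ hc hcκ m n⟩

theorem summable_beamsplitterMixture (hp0 : ∀ m, 0 ≤ p m) (hp : Summable p) (hlam : 0 ≤ lam)
    (hη : η ∈ Set.Icc (0 : ℝ) 1) (n : ℕ) :
    Summable fun m => p m * PowerSeries.coeff n (beamsplitterSeries lam η m) :=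
  hp.of_nonneg_of_le
    (fun m => mul_nonneg (hp0 m) (coeff_beamsplitterSeries_mem_Icc hlam hη m n).1)
    fun m => mul_le_of_le_one_right (hp0 m) (coeff_beamsplitterSeries_mem_Icc hlam hη m n).2

theorem beamsplitterMixture_nonneg (hp0 : ∀ m, 0 ≤ p m) (hlam : 0 ≤ lam)
    (hη : η ∈ Set.Icc (0 : ℝ) 1) (n : ℕ) : 0 ≤ beamsplitterMixture p lam η n :=
  tsum_nonneg fun m => mul_nonneg (hp0 m) (coeff_beamsplitterSeries_mem_Icc hlam hη m n).1

theorem hasSum_coeff_beamsplitterSeries (hlam : 0 ≤ lam) (hη : η ∈ Set.Icc (0 : ℝ) 1) (m : ℕ) :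
    HasSum (fun n => PowerSeries.coeff n (beamsplitterSeries lam η m)) 1 :=
  (hasAbsSum_kernelSeries (mul_nonneg (by linarith [hη.2]) hlam) _ m).2

theorem hasSum_beamsplitterMixture (hp0 : ∀ m, 0 ≤ p m) (hp : Summable p) (hlam : 0 ≤ lam)
    (hη : η ∈ Set.Icc (0 : ℝ) 1) : HasSum (beamsplitterMixture p lam η) (∑' m, p m) := by
  have hk := coeff_beamsplitterSeries_mem_Icc hlam hη
  have h1 := fun m => (hasSum_coeff_beamsplitterSeries hlam hη m).mul_right 1
  have h := hasSum_mixture hp0 hp (fun m n => (hk m n).1) (fun m n => (hk m n).2)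
    (g := fun _ => 1) (b := fun _ => 1) (fun _ => by simp) h1 h1 (by simpa using hp)
  simp only [mul_one] at h
  exact h

theorem hasSum_mul_beamsplitterMixture (hp0 : ∀ m, 0 ≤ p m) (hp : Summable p) {M : ℝ}
    (hpm : HasSum (fun m : ℕ => p m * m) M) (hlam : 0 ≤ lam) (hη : η ∈ Set.Icc (0 : ℝ) 1) :
    HasSum (fun n : ℕ => n * beamsplitterMixture p lam η n)
      (η * M + (1 - η) * lam * ∑' m, p m) := by
  have hk := coeff_beamsplitterSeries_mem_Icc hlam hη
  have h1 : ∀ m, HasSum (fun n : ℕ => PowerSeries.coeff n (beamsplitterSeries lam η m) * (n : ℝ))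
      (η * m + (1 - η) * lam) := fun m => by
    convert! hasSum_mul_coeff_kernelSeries (mul_nonneg (sub_nonneg.2 hη.2) hlam)
      ((1 - η) * (1 + lam)) m using 1
    · ext n
      rw [mul_comm, beamsplitterSeries]
    · ring
  have h2 : HasSum (fun m : ℕ => p m * (η * m + (1 - η) * lam))
      (η * M + (1 - η) * lam * ∑' m, p m) := by
    convert! (hpm.mul_left η).add (hp.hasSum.mul_left ((1 - η) * lam)) using 2 with m
    ring
  have h := hasSum_mixture hp0 hp (fun m n => (hk m n).1) (fun m n => (hk m n).2)
    (fun n => (Nat.abs_cast n).le) h1 h1 h2.summable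
  rw [h2.tsum_eq] at h
  convert! h using 2 with n
  rw [mul_comm, beamsplitterMixture]

theorem hasSum_beamsplitterMixture_mul_laguerreExp (hp0 : ∀ m, 0 ≤ p m) (hp : Summable p)
    (hlam : 0 ≤ lam) (hη : η ∈ Set.Icc (0 : ℝ) 1) {x : ℝ} (hx : 0 ≤ x) :
    HasSum (fun n => beamsplitterMixture p lam η n * laguerreExp n x)
      ((∑' m, p m * laguerreExp m (η * x)) * Real.exp (-((1 - η) * (1 + lam)) * x)) := by
  have hk := coeff_beamsplitterSeries_mem_Icc hlam hη
  have h1 : 0 ≤ 1 - η := by linarith [hη.2]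
  have hG : ∀ m, HasSum
      (fun n => PowerSeries.coeff n (beamsplitterSeries lam η m) * laguerreExp n x)
      (laguerreExp m (η * x) * Real.exp (-((1 - η) * (1 + lam)) * x)) := fun m => by
    have h := hasSum_coeff_kernelSeries_mul_laguerreExp (κ := (1 - η) * lam)
      (c := (1 - η) * (1 + lam)) (by positivity) (by positivity) (by linarith [hη.1]) hx m
    rwa [show 1 + (1 - η) * lam - (1 - η) * (1 + lam) = η by ring] at h
  have h := hasSum_mixture hp0 hp (fun m n => (hk m n).1) (fun m n => (hk m n).2)
    (b := fun _ => 1) (fun n => abs_laguerreExp_le_one n hx) hG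
    (fun m => (hasSum_coeff_beamsplitterSeries hlam hη m).mul_right 1) (by simpa using hp)
  simp_rw [← mul_assoc, tsum_mul_right] at h
  exact h

/-- Beamsplitter addition of a geometric variable is the mixture of the kernel: both sides have
the same characteristic function on the plane. -/
theorem beamsplitterAdd_geometric (hp0 : ∀ m, 0 ≤ p m) (hp : Summable p) {θ : ℝ}
    (hθ : θ ∈ Set.Ioc (0 : ℝ) 1) {q : ℕ → ℝ} (hq : ∀ n, q n = (1 - θ) ^ n * θ)
    (hlam : 1 + lam = θ⁻¹) (hη : η ∈ Set.Icc (0 : ℝ) 1) (n : ℕ) :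
    beamsplitterAdd η p q n = beamsplitterMixture p lam η n := by
  have hθ1 : 0 ≤ 1 - θ := by linarith [hθ.2]
  have hlam0 : 0 ≤ lam := by
    have := (one_le_inv₀ hθ.1).2 hθ.2
    linarith
  have hq0 : ∀ n, 0 ≤ q n := fun n => by
    rw [hq]
    exact mul_nonneg (pow_nonneg hθ1 n) hθ.1.le
  have hqs : Summable q := by
    simp_rw [funext hq]
    exact (summable_geometric_of_lt_one hθ1 (by linarith [hθ.1])).mul_right _
  have hqchar : ∀ x, ∑' m, q m * laguerreExp m x = Real.exp (-(1 + lam) * x) := fun x => by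
    have h := (hasSum_laguerreExp_generating ⟨hθ1, by linarith [hθ.1]⟩ x).mul_left θ
    rw [sub_sub_cancel, mul_div_cancel₀ _ hθ.1.ne'] at h
    rw [hlam, show -θ⁻¹ * x = -x / θ by rw [div_eq_mul_inv]; ring, ← h.tsum_eq]
    refine tsum_congr fun m => ?_
    rw [hq]
    ring
  refine inverseMap_eq (beamsplitterMixture_nonneg hp0 hlam0 hη)
    (hasSum_beamsplitterMixture hp0 hp hlam0 hη).summable (fun s => ?_) n
  have hnorm : ∀ t : ℝ, 0 ≤ t → ‖(Real.sqrt t : ℂ) * s‖ ^ 2 = t * ‖s‖ ^ 2 := fun t ht => by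
    rw [norm_mul, mul_pow, Complex.norm_real, Real.norm_of_nonneg (Real.sqrt_nonneg t),
      Real.sq_sqrt ht]
  rw [integral_planeChar_mixedLaw, integral_planeChar_continuousLaw hp0 hp,
    integral_planeChar_continuousLaw hq0 hqs, hnorm η hη.1, hnorm (1 - η) (by linarith [hη.2]),
    hqchar, (hasSum_beamsplitterMixture_mul_laguerreExp hp0 hp hlam0 hη (sq_nonneg ‖s‖)).tsum_eq,
    ← Complex.ofReal_mul]
  congr 3
  ring

/-- The heat equation follows from the forward equation of the kernel term by term. The
derivatives are bounded uniformly in `m` on `[η / 2, 1]`, since the forward equation expresses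
them through entries of the kernel, which lie in `[0, 1]`. -/
theorem hasDerivWithinAt_beamsplitterMixture (hp0 : ∀ m, 0 ≤ p m) (hp : Summable p)
    (hlam : 0 ≤ lam) (hη : η ∈ Set.Ioc (0 : ℝ) 1) (n : ℕ) :
    HasDerivWithinAt (fun t => beamsplitterMixture p lam t n)
      (fwdDiff 1 (fun j : ℕ => (j : ℝ) / η *
        (beamsplitterMixture p lam η (j - 1) * lam - beamsplitterMixture p lam η j * (1 + lam))) n)
      (Set.Icc 0 1) η := by
  have hsub : Set.Icc (η / 2) 1 ⊆ Set.Icc 0 1 := Set.Icc_subset_Icc_left (by linarith [hη.1])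
  have hw : ∀ m j : ℕ, ∀ t ∈ Set.Icc (η / 2) 1, |(j : ℝ) / t *
      (PowerSeries.coeff (j - 1) (beamsplitterSeries lam t m) * lam -
        PowerSeries.coeff j (beamsplitterSeries lam t m) * (1 + lam))| ≤
      j / (η / 2) * (1 + 2 * lam) := by
    intro m j t ht
    have ht0 : 0 < η / 2 := by linarith [hη.1]
    have ht1 : 0 < t := ht0.trans_le ht.1
    obtain ⟨ha0, ha1⟩ := coeff_beamsplitterSeries_mem_Icc hlam (hsub ht) m (j - 1)
    obtain ⟨hb0, hb1⟩ := coeff_beamsplitterSeries_mem_Icc hlam (hsub ht) m j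
    rw [abs_mul, abs_of_nonneg (by positivity : 0 ≤ (j : ℝ) / t)]
    refine mul_le_mul (div_le_div_of_nonneg_left (Nat.cast_nonneg j) ht0 ht.1) ?_ (abs_nonneg _)
      (by positivity)
    have h1 := mul_le_of_le_one_left hlam ha1
    have h2 := mul_nonneg ha0 hlam
    have h3 := mul_le_of_le_one_left (by linarith : 0 ≤ 1 + lam) hb1
    have h4 := mul_nonneg hb0 (by linarith : 0 ≤ 1 + lam)
    rw [abs_le]
    constructor <;> linarith
  have key := hasDerivWithinAt_tsum_of_bounded (convex_Icc (η / 2) 1)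
    (f := fun m t => p m * PowerSeries.coeff n (beamsplitterSeries lam t m))
    (f' := fun m t => p m * fwdDiff 1 (fun j : ℕ => (j : ℝ) / t *
        (PowerSeries.coeff (j - 1) (beamsplitterSeries lam t m) * lam -
          PowerSeries.coeff j (beamsplitterSeries lam t m) * (1 + lam))) n)
    (C := fun m => p m * ((n + 1 : ℕ) / (η / 2) * (1 + 2 * lam) + n / (η / 2) * (1 + 2 * lam)))
    (hp.mul_right _) (fun m t ht => ?_) (fun m t ht => ?_)
    (fun t ht => summable_beamsplitterMixture hp0 hp hlam (hsub ht) n)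
    (t := η) ⟨by linarith [hη.1], hη.2⟩
  · have hmem : Set.Icc (η / 2) 1 ∈ nhdsWithin η (Set.Icc 0 1) := by
      filter_upwards [self_mem_nhdsWithin,
        mem_nhdsWithin_of_mem_nhds (Ici_mem_nhds (by linarith [hη.1] : η / 2 < η))] with t h1 h2
      exact ⟨h2, h1.2⟩
    convert! key.mono_of_mem_nhdsWithin hmem using 1
    have hη' : η ∈ Set.Icc (0 : ℝ) 1 := ⟨hη.1.le, hη.2⟩
    have hs : ∀ j : ℕ, HasSum (fun m => p m * ((j : ℝ) / η *
        (PowerSeries.coeff (j - 1) (beamsplitterSeries lam η m) * lam -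
          PowerSeries.coeff j (beamsplitterSeries lam η m) * (1 + lam))))
        ((j : ℝ) / η * (beamsplitterMixture p lam η (j - 1) * lam -
          beamsplitterMixture p lam η j * (1 + lam))) := fun j => by
      have h := (((summable_beamsplitterMixture hp0 hp hlam hη' (j - 1)).hasSum.mul_right lam).sub
        ((summable_beamsplitterMixture hp0 hp hlam hη' j).hasSum.mul_right (1 + lam))).mul_left
          ((j : ℝ) / η)
      convert! h using 2 with m
      ring
    have h := ((hs (n + 1)).sub (hs n)).tsum_eq
    simp_rw [← mul_sub (p _)] at h
    exact h.symm
  · have ht0 : 0 < t := lt_of_lt_of_le (by linarith [hη.1]) ht.1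
    have h1 : 0 ≤ (1 - t) * lam := mul_nonneg (by linarith [ht.2]) hlam
    exact ((hasDerivAt_coeff_beamsplitterSeries ht0.ne' (by positivity) m n).const_mul
      (p m)).hasDerivWithinAt
  · rw [norm_mul, Real.norm_of_nonneg (hp0 m), fwdDiff]
    refine mul_le_mul_of_nonneg_left ((norm_sub_le _ _).trans ?_) (hp0 m)
    exact add_le_add (hw m (n + 1) t ht) (hw m n t ht)

end Mixture

/-! ### Mass functions of random variables -/

section Pmf

variable {Ω : Type*} [MeasurableSpace Ω] {P : Measure Ω} {W : Ω → ℕ}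

theorem hasSum_pmfOf_mul (hW : Measurable W) {f : ℕ → ℝ}
    (hf : Integrable (fun ω => f (W ω)) P) :
    HasSum (fun n => pmfOf P W n * f n) (∫ ω, f (W ω) ∂P) := by
  have h := hasSum_integral_iUnion (μ := P) (s := fun n => W ⁻¹' {n}) (f := fun ω => f (W ω))
    (fun n => hW (measurableSet_singleton n))
    (fun m n hmn => Disjoint.preimage W (by simpa using hmn)) hf.integrableOn
  rw [← Set.preimage_iUnion, Set.iUnion_of_singleton, Set.preimage_univ,
    setIntegral_univ] at h
  convert! h using 2 with n
  rw [setIntegral_congr_fun (g := fun _ => f n) (hW (measurableSet_singleton n))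
    (fun ω hω => by rw [Set.mem_preimage, Set.mem_singleton_iff] at hω; simp only [hω]),
    setIntegral_const, smul_eq_mul, pmfOf]

theorem pmfOf_geometric {θ : unitInterval} (hθ : θ ≠ 0) (hW : HasLaw W (geometricMeasure θ) P)
    (n : ℕ) : pmfOf P W n = (1 - (θ : ℝ)) ^ n * θ := by
  rw [← geometricMeasure_real_singleton hθ, ← hW.map_eq, pmfOf,
    map_measureReal_apply_of_aemeasurable hW.aemeasurable (measurableSet_singleton n)]

theorem one_add_integral_geometric {θ : unitInterval} (hθ : θ ≠ 0)
    (hW : HasLaw W (geometricMeasure θ) P) : 1 + ∫ ω, (W ω : ℝ) ∂P = (θ : ℝ)⁻¹ := by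
  have hθ0 : 0 < (θ : ℝ) := unitInterval.pos_iff_ne_zero.2 hθ
  have hnorm : ‖1 - (θ : ℝ)‖ < 1 := by
    rw [Real.norm_of_nonneg (by linarith [θ.2.2])]
    linarith
  have h := hW.integral_comp (f := fun n : ℕ => (n : ℝ)) (by fun_prop)
  rw [integral_geometricMeasure hθ] at h
  have h1 : ∀ n : ℕ, ((1 - (θ : ℝ)) ^ n * θ) • (n : ℝ) = n * (1 - (θ : ℝ)) ^ n * θ := fun n => by
    rw [smul_eq_mul]
    ring
  simp_rw [h1] at h
  rw [tsum_mul_right, tsum_coe_mul_geometric_of_norm_lt_one hnorm, sub_sub_cancel] at h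
  simp only [Function.comp_def] at h
  rw [h]
  field_simp
  ring

end Pmf

end Beamsplitter

theorem theorem3 {Ω : Type*} [MeasurableSpace Ω] (P : Measure Ω) [IsProbabilityMeasure P]
    (X Y : Ω → ℕ) (hX : Measurable X)
    (θ : unitInterval) (hθ : θ ≠ 0) (hY : HasLaw Y (geometricMeasure θ) P)
    (lamX lamY : ℝ) (hlamX : lamX = ∫ ω, (X ω : ℝ) ∂P) (hlamY : lamY = ∫ ω, (Y ω : ℝ) ∂P)
    (pZ : ℝ → ℕ → ℝ)
    (hpZ : ∀ η n, pZ η n =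
      Beamsplitter.beamsplitterAdd η (Beamsplitter.pmfOf P X) (Beamsplitter.pmfOf P Y) n) :
    -- `pZ η` is the mass function of a random variable `Z_η` valued in `ℕ`
    (∀ η ∈ Set.Icc (0 : ℝ) 1, (∀ n, 0 ≤ pZ η n) ∧ HasSum (pZ η) 1) ∧
    -- the mean of `Z_η` is `η λ_X + (1 - η) λ_Y`
    (Integrable (fun ω => (X ω : ℝ)) P → ∀ η ∈ Set.Icc (0 : ℝ) 1,
      HasSum (fun n : ℕ => (n : ℝ) * pZ η n) (η * lamX + (1 - η) * lamY)) ∧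
    -- the discrete heat equation (one-sided derivative at `η = 1`);
    -- for `m = 0` the factor `m` kills the term with `m - 1`
    (∀ η ∈ Set.Ioc (0 : ℝ) 1, ∀ n : ℕ,
      HasDerivWithinAt (fun η' => pZ η' n)
        (fwdDiff 1 (fun m : ℕ =>
          (m : ℝ) / η * (pZ η (m - 1) * lamY - pZ η m * (1 + lamY))) n)
        (Set.Icc 0 1) η) := by
  have hp0 : ∀ m, 0 ≤ Beamsplitter.pmfOf P X m := fun m => measureReal_nonneg
  have hp1 : HasSum (Beamsplitter.pmfOf P X) 1 := by
    simpa using Beamsplitter.hasSum_pmfOf_mul hX (f := fun _ => 1) (P := P) (integrable_const 1)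
  have hθ' : (θ : ℝ) ∈ Set.Ioc (0 : ℝ) 1 := ⟨unitInterval.pos_iff_ne_zero.2 hθ, θ.2.2⟩
  have hlam : 1 + lamY = (θ : ℝ)⁻¹ := hlamY ▸ Beamsplitter.one_add_integral_geometric hθ hY
  have hlam0 : 0 ≤ lamY := hlamY ▸ integral_nonneg fun ω => Nat.cast_nonneg _
  have hpZ' : ∀ η ∈ Set.Icc (0 : ℝ) 1,
      pZ η = Beamsplitter.beamsplitterMixture (Beamsplitter.pmfOf P X) lamY η := fun η hη => by
    ext n
    rw [hpZ, Beamsplitter.beamsplitterAdd_geometric hp0 hp1.summable hθ'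
      (Beamsplitter.pmfOf_geometric hθ hY) hlam hη]
  refine ⟨fun η hη => ?_, fun hint η hη => ?_, fun η hη n => ?_⟩
  · rw [hpZ' η hη, ← hp1.tsum_eq]
    exact ⟨Beamsplitter.beamsplitterMixture_nonneg hp0 hlam0 hη,
      Beamsplitter.hasSum_beamsplitterMixture hp0 hp1.summable hlam0 hη⟩
  · have hmean := Beamsplitter.hasSum_pmfOf_mul hX (f := fun n => (n : ℝ)) hint
    have h := Beamsplitter.hasSum_mul_beamsplitterMixture hp0 hp1.summable hmean hlam0 hη
    rwa [hp1.tsum_eq, mul_one, ← hlamX, ← hpZ' η hη] at h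
  · have hη' : η ∈ Set.Icc (0 : ℝ) 1 := ⟨hη.1.le, hη.2⟩
    rw [hpZ' η hη']
    refine (Beamsplitter.hasDerivWithinAt_beamsplitterMixture hp0 hp1.summable hlam0 hη
      n).congr_of_mem (fun t ht => ?_) hη'
    rw [hpZ' t ht]
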